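/- **Definitions.** A *t-norm* is a map $T:[0,1]^2\to[0,1]$ that is commutative, associative, monotone in each variable and satisfies $T(x,1)=x$; its *dual t-conorm* is $S(x,y)=1-T(1-x,1-y)$. $T$ is *strict* if it is continuous and $T(x,y)<T(x,z)$ whenever $x>0$ and $y<z$. $T$ is an *ordinal sum of strict t-norms* if there are a finite or countably infinite index set $A$, non-empty pairwise disjoint open subintervals $(a_i,e_i)$ of $[0,1]$ and strict t-norms $T_i$ $(i\in A)$ with $T(x,y)=a_i+(e_i-a_i)\,T_i\!\left(\frac{x-a_i}{e_i-a_i},\frac{y-a_i}{e_i-a_i}\right)$ if $(x,y)\in[a_i,e_i]^2$ for some $i$, and $T(x,y)=\min\{x,y\}$ otherwise. For a continuous t-norm $T$ with dual t-conorm $S$ and $u\in[0,1]$ put $u_T^{(0)}=1$, $u_T^{(m+1)}=T(u_T^{(m)},u)$, and $u_S^{(0)}=0$, $u_S^{(m+1)}=S(u_S^{(m)},u)$ for integers $m\ge 0$. For integers $p\ge1$, $q\ge0$ let $u_T^{(1/p)}=\sup\{v\in[0,1]: v_T^{(p)}<u\}$, $u_S^{(1/p)}=\inf\{v\in[0,1]: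 v_S^{(p)}>u\}$ (infima and suprema taken in $[0,1]$, so $\sup\varnothing=0$ and $\inf\varnothing=1$), $u_T^{(q/p)}=(u_T^{(1/p)})_T^{(q)}$ and $u_S^{(q/p)}=(u_S^{(1/p)})_S^{(q)}$, where $q/p$ is in lowest terms. For real $t>0$ let $$u_T^{(t)}=\inf\{u_T^{(r)}: r\in[0,t]\cap\mathbb Q\},\qquad u_S^{(t)}=\sup\{u_S^{(r)}: r\in[0,t]\cap\mathbb Q\}.$$ An *intuitionistic fuzzy (IF) value* is a pair $\alpha=\langle\mu_\alpha,\nu_\alpha\rangle\in[0,1]^2$ with $\mu_\alpha+\nu_\alpha\le1$. For IF values $\alpha,\beta$ and $\lambda>0$ define the IF values $$\alpha\oplus_T\beta=\langle S(\mu_\alpha,\mu_\beta),T(\nu_\alpha,\nu_\beta)\rangle,\quad \alpha\otimes_T\beta=\langle T(\mu_\alpha,\mu_\beta),S(\nu_\alpha,\nu_\beta)\rangle,$$ $$\lambda_T\alpha=\langle(\mu_\alpha)_S^{(\lambda)},(\nu_\alpha)_T^{(\lambda)}\rangle,\quad \alpha^{\lambda_T}=\langle(\mu_\alpha)_T^{(\lambda)},(\nu_\alpha)_S^{(\lambda)}\rangle.$$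 **Theorem.** Let $T$ be a continuous t-norm, let $\gamma_1,\gamma_2,\gamma_3$ be IF values and let $\zeta,\xi,\lambda>0$. Then - (i) $\gamma_1\oplus_T\gamma_2=\gamma_2\oplus_T\gamma_1$; - (ii) $\gamma_1\otimes_T\gamma_2=\gamma_2\otimes_T\gamma_1$; - (iii) $(\gamma_1\oplus_T\gamma_2)\oplus_T\gamma_3=\gamma_1\oplus_T(\gamma_2\oplus_T\gamma_3)$; - (iv) $(\gamma_1\otimes_T\gamma_2)\otimes_T\gamma_3=\gamma_1\otimes_T(\gamma_2\otimes_T\gamma_3)$; - (v) $(\xi_T\gamma_1)\oplus_T(\zeta_T\gamma_1)=(\xi+\zeta)_T\gamma_1$; - (vi) $\gamma_1^{\xi_T}\otimes_T\gamma_1^{\zeta_T}=\gamma_1^{(\xi+\zeta)_T}$. If moreover $T$ is the minimum t-norm, or $T$ is strict, or $T$ is an ordinal sum of strict t-norms, then - (vii) $\lambda_T(\gamma_1\oplus_T\gamma_2)=(\lambda_T\gamma_1)\oplus_T(\lambda_T\gamma_2)$; - (viii) $(\gamma_1\otimes_T\gamma_2)^{\lambda_T}=\gamma_1^{\lambda_T}\otimes_T\gamma_2^{\lambda_T}$;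 - (ix) $(\gamma_1^{\lambda_T})^{\xi_T}=\gamma_1^{(\lambda\xi)_T}$; - (x) $\xi_T(\lambda_T\gamma_1)=(\lambda\xi)_T\gamma_1$. -/

import Mathlib

open scoped unitInterval

/-- A triangular norm on `[0, 1]`: commutative, associative, monotone, with neutral element `1`. -/
structure TNorm where
  toFun : I → I → I
  comm : ∀ x y, toFun x y = toFun y x
  assoc : ∀ x y z, toFun x (toFun y z) = toFun (toFun x y) z
  mono : ∀ x y z, y ≤ z → toFun x y ≤ toFun x z
  neutral : ∀ x, toFun x 1 = x

/-- A triangular conorm on `[0, 1]`: commutative, associative, monotone, with neutral element `0`. -/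
structure TConorm where
  toFun : I → I → I
  comm : ∀ x y, toFun x y = toFun y x
  assoc : ∀ x y z, toFun x (toFun y z) = toFun (toFun x y) z
  mono : ∀ x y z, y ≤ z → toFun x y ≤ toFun x z
  neutral : ∀ x, toFun x 0 = x

namespace TConorm

/-- The `m`-fold power `u_S^{(m)}` (with `u_S^{(0)} = 0`). -/
def npow (S : TConorm) (u : I) : ℕ → I
  | 0 => 0
  | m + 1 => S.toFun (S.npow u m) u

/-- The `n`-th root `u_S^{(1/n)} = inf {v ∈ [0,1] | v_S^{(n)} > u}`; the infimum is taken in the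
complete lattice `[0, 1]`, so the infimum of the empty set is `1`. -/
noncomputable def root (S : TConorm) (u : I) (n : ℕ) : I :=
  sInf {v : I | u < S.npow v n}

/-- The rational power `u_S^{(q/p)} = (u_S^{(1/p)})_S^{(q)}`, for the reduced fraction `q/p`. -/
noncomputable def ratPow (S : TConorm) (u : I) (r : ℚ≥0) : I :=
  S.npow (S.root u r.den) r.num

/-- The real power `u_S^{(t)} = sup {u_S^{(r)} | r ∈ [0, t] ∩ ℚ}`, for `t > 0`. -/
noncomputable def rpow (S : TConorm) (u : I) (t : ℝ) : I :=
  sSup {x : I | ∃ r : ℚ≥0, (r : ℝ) ≤ t ∧ x = S.ratPow u r}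

end TConorm

namespace TNorm

/-- Joint continuity of `T` on `[0, 1]²`. -/
def IsContinuous (T : TNorm) : Prop :=
  Continuous fun p : I × I => T.toFun p.1 p.2

/-- `T` is strict: continuous, and `T(x, y) < T(x, z)` whenever `x > 0` and `y < z`. -/
def IsStrict (T : TNorm) : Prop :=
  T.IsContinuous ∧ ∀ x y z : I, 0 < x → y < z → T.toFun x y < T.toFun x z

/-- The minimum t-norm `T_M`. -/
def minimum : TNorm where
  toFun x y := min x y
  comm x y := min_comm x y
  assoc x y z := (min_assoc x y z).symm
  mono _ _ _ h := min_le_min le_rfl h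
  neutral x := min_eq_left (unitInterval.le_one' (t := x))

/-- The `m`-fold power `u_T^{(m)}` (with `u_T^{(0)} = 1`). -/
def npow (T : TNorm) (u : I) : ℕ → I
  | 0 => 1
  | m + 1 => T.toFun (T.npow u m) u

/-- The `n`-th root `u_T^{(1/n)} = sup {v ∈ [0,1] | v_T^{(n)} < u}`; the supremum is taken in the
complete lattice `[0, 1]`, so the supremum of the empty set is `0`. -/
noncomputable def root (T : TNorm) (u : I) (n : ℕ) : I :=
  sSup {v : I | T.npow v n < u}

/-- The rational power `u_T^{(q/p)} = (u_T^{(1/p)})_T^{(q)}`, for the reduced fraction `q/p`. -/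
noncomputable def ratPow (T : TNorm) (u : I) (r : ℚ≥0) : I :=
  T.npow (T.root u r.den) r.num

/-- The real power `u_T^{(t)} = inf {u_T^{(r)} | r ∈ [0, t] ∩ ℚ}`, for `t > 0`. -/
noncomputable def rpow (T : TNorm) (u : I) (t : ℝ) : I :=
  sInf {x : I | ∃ r : ℚ≥0, (r : ℝ) ≤ t ∧ x = T.ratPow u r}

/-- The dual t-conorm `S(x, y) = 1 - T(1 - x, 1 - y)` (here `σ x = 1 - x`). -/
def dual (T : TNorm) : TConorm where
  toFun x y := σ (T.toFun (σ x) (σ y))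
  comm x y := by rw [T.comm]
  assoc x y z := by simp only [unitInterval.symm_symm, T.assoc]
  mono x y z h :=
    unitInterval.symm_le_symm.2 (T.mono _ _ _ (unitInterval.symm_le_symm.2 h))
  neutral x := by rw [unitInterval.symm_zero, T.neutral, unitInterval.symm_symm]

end TNorm

/-- The point `(x - a) / (e - a)` of `[0, 1]`, for `x ∈ [a, e]` and `a < e`. -/
noncomputable def rescale (a e x : I) (hae : a < e) (hx : x ∈ Set.Icc a e) : I :=
  ⟨((x : ℝ) - a) / (e - a),
    div_nonneg (sub_nonneg.2 hx.1) (sub_nonneg.2 hae.le),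
    div_le_one_of_le₀ (sub_le_sub_right (show (x : ℝ) ≤ e from hx.2) (a : ℝ))
      (sub_nonneg.2 hae.le)⟩

/-- `T` is the ordinal sum of the summands `⟨a i, e i, T' i⟩`, where the `(a i, e i)` are non-empty,
pairwise disjoint open subintervals of `[0, 1]`. -/
def TNorm.IsOrdinalSum (T : TNorm) {ι : Type} (a e : ι → I) (T' : ι → TNorm) : Prop :=
  ∃ hae : ∀ i, a i < e i,
    (∀ i j, i ≠ j → Disjoint (Set.Ioo (a i : ℝ) (e i)) (Set.Ioo (a j : ℝ) (e j))) ∧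
    (∀ (i : ι) (x y : I) (hx : x ∈ Set.Icc (a i) (e i)) (hy : y ∈ Set.Icc (a i) (e i)),
      (T.toFun x y : ℝ) = a i + (e i - a i) *
        (T' i).toFun (rescale (a i) (e i) x (hae i) hx) (rescale (a i) (e i) y (hae i) hy)) ∧
    (∀ x y : I, (¬ ∃ i, x ∈ Set.Icc (a i) (e i) ∧ y ∈ Set.Icc (a i) (e i)) →
      T.toFun x y = min x y)

/-- `T` is an ordinal sum of a (finite or countably infinite) family of strict t-norms. -/
def TNorm.IsOrdinalSumOfStrict (T : TNorm) : Prop :=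
  ∃ (ι : Type) (_ : Countable ι) (a e : ι → I) (T' : ι → TNorm),
    (∀ i, (T' i).IsStrict) ∧ T.IsOrdinalSum a e T'

namespace TNorm

theorem mono₂ (T : TNorm) {x x' y y' : I} (hx : x ≤ x') (hy : y ≤ y') :
    T.toFun x y ≤ T.toFun x' y' :=
  (T.mono x y y' hy).trans (by rw [T.comm x, T.comm x']; exact T.mono _ _ _ hx)

theorem npow_mono (T : TNorm) {u v : I} (h : u ≤ v) (n : ℕ) : T.npow u n ≤ T.npow v n := by
  induction n with
  | zero => exact le_rfl
  | succ n ih => exact T.mono₂ ih h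

theorem rpow_mono (T : TNorm) {u v : I} (h : u ≤ v) (t : ℝ) : T.rpow u t ≤ T.rpow v t := by
  refine le_sInf ?_
  rintro _ ⟨r, hr, rfl⟩
  have hroot : T.root u r.den ≤ T.root v r.den :=
    sSup_le_sSup fun w (hw : T.npow w r.den < u) => lt_of_lt_of_le hw h
  have hmem : T.rpow u t ≤ T.ratPow u r := sInf_le ⟨r, hr, rfl⟩
  exact hmem.trans (T.npow_mono hroot _)

theorem dual_npow (T : TNorm) (u : I) (n : ℕ) : T.dual.npow u n = σ (T.npow (σ u) n) := by
  induction n with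
  | zero => exact unitInterval.symm_one.symm
  | succ n ih =>
    change σ (T.toFun (σ (T.dual.npow u n)) (σ u)) = _
    rw [ih, unitInterval.symm_symm]
    rfl

theorem dual_root (T : TNorm) (u : I) (n : ℕ) : T.dual.root u n = σ (T.root (σ u) n) := by
  apply le_antisymm
  · rw [unitInterval.le_symm_comm]
    refine sSup_le fun v hv => ?_
    rw [unitInterval.le_symm_comm]
    refine sInf_le ?_
    change u < T.dual.npow (σ v) n
    rw [dual_npow, unitInterval.symm_symm]
    exact unitInterval.lt_symm_comm.1 hv
  · refine le_sInf fun v hv => ?_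
    rw [unitInterval.symm_le_comm]
    refine le_sSup ?_
    change u < T.dual.npow v n at hv
    rw [dual_npow] at hv
    exact unitInterval.lt_symm_comm.1 hv

theorem dual_rpow_le (T : TNorm) (u : I) (t : ℝ) : T.dual.rpow u t ≤ σ (T.rpow (σ u) t) := by
  refine sSup_le ?_
  rintro _ ⟨r, hr, rfl⟩
  rw [unitInterval.le_symm_comm]
  refine sInf_le ⟨r, hr, ?_⟩
  simp only [TConorm.ratPow, ratPow, dual_npow, dual_root, unitInterval.symm_symm]

end TNorm

/-- An intuitionistic fuzzy value `⟨μ, ν⟩`: a pair in `[0, 1]²` with `μ + ν ≤ 1`. -/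
@[ext]
structure IFValue where
  mu : I
  nu : I
  add_le_one : (mu : ℝ) + nu ≤ 1

namespace IFValue

theorem add_le_of_le_symm {x y : I} (h : x ≤ σ y) : (x : ℝ) + y ≤ 1 := by
  have : (x : ℝ) ≤ 1 - y := h
  linarith

theorem mu_le (α : IFValue) : α.mu ≤ σ α.nu := by
  have := α.add_le_one
  change (α.mu : ℝ) ≤ 1 - α.nu
  linarith

theorem nu_le (α : IFValue) : α.nu ≤ σ α.mu := unitInterval.le_symm_comm.1 α.mu_le

/-- `α ⊕_T β = ⟨S(μ_α, μ_β), T(ν_α, ν_β)⟩`, with `S` the dual t-conorm of `T`. -/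
def oplus (T : TNorm) (α β : IFValue) : IFValue where
  mu := T.dual.toFun α.mu β.mu
  nu := T.toFun α.nu β.nu
  add_le_one := add_le_of_le_symm
    (unitInterval.symm_le_symm.2 (T.mono₂ α.nu_le β.nu_le))

/-- `α ⊗_T β = ⟨T(μ_α, μ_β), S(ν_α, ν_β)⟩`, with `S` the dual t-conorm of `T`. -/
def otimes (T : TNorm) (α β : IFValue) : IFValue where
  mu := T.toFun α.mu β.mu
  nu := T.dual.toFun α.nu β.nu
  add_le_one := add_le_of_le_symm (unitInterval.le_symm_comm.1
    (unitInterval.symm_le_symm.2 (T.mono₂ α.mu_le β.mu_le)))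

/-- The scalar multiple `l_T α = ⟨(μ_α)_S^{(l)}, (ν_α)_T^{(l)}⟩`, for `l > 0`. -/
noncomputable def smul (T : TNorm) (l : ℝ) (α : IFValue) : IFValue where
  mu := T.dual.rpow α.mu l
  nu := T.rpow α.nu l
  add_le_one := add_le_of_le_symm ((T.dual_rpow_le _ _).trans
    (unitInterval.symm_le_symm.2 (T.rpow_mono α.nu_le l)))

/-- The power `α^{l_T} = ⟨(μ_α)_T^{(l)}, (ν_α)_S^{(l)}⟩`, for `l > 0`. -/
noncomputable def power (T : TNorm) (α : IFValue) (l : ℝ) : IFValue where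
  mu := T.rpow α.mu l
  nu := T.dual.rpow α.nu l
  add_le_one := add_le_of_le_symm (unitInterval.le_symm_comm.1 ((T.dual_rpow_le _ _).trans
    (unitInterval.symm_le_symm.2 (T.rpow_mono α.mu_le l))))

end IFValue

/-! By duality `σ` every component reduces to a statement about `T`, so (i)–(iv) are the axioms of
`T`, and the rest concerns real powers. For (v), (vi): by continuity `T.root u p` is the least `v`
with `T.npow v p = u`, which makes rational powers independent of the fraction and additive
(`ratPow_add`). Passing to real exponents needs left continuity in the exponent
(`le_ratPow_of_forall_lt`): a rational `r = s + t` need not split into rationals below `s` and `t`,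
but every smaller one does. For (vii)–(x): all three classes have a strictly increasing diagonal `x
↦ T(x, x)`. This forces each power map to be injective (`npow_injective`), so roots are unique and
commute with products and powers. -/

namespace TNorm

/-! ### Integer powers -/

section Algebra

variable (T : TNorm)

theorem le_right (x y : I) : T.toFun x y ≤ y := by
  rw [T.comm]
  exact (T.mono y x 1 unitInterval.le_one').trans_eq (T.neutral y)

theorem le_left (x y : I) : T.toFun x y ≤ x :=
  (T.comm x y).trans_le (T.le_right y x)

theorem one_left (x : I) : T.toFun 1 x = x := by
  rw [T.comm, T.neutral]

theorem toFun_toFun_toFun_comm (a b c d : I) :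
    T.toFun (T.toFun a b) (T.toFun c d) = T.toFun (T.toFun a c) (T.toFun b d) := by
  rw [← T.assoc, T.assoc b, T.comm b c, ← T.assoc c, T.assoc a]

theorem npow_succ (u : I) (n : ℕ) : T.npow u (n + 1) = T.toFun (T.npow u n) u := rfl

theorem npow_one (u : I) : T.npow u 1 = u := T.one_left u

theorem npow_add (u : I) (m n : ℕ) :
    T.npow u (m + n) = T.toFun (T.npow u m) (T.npow u n) := by
  induction n with
  | zero => exact (T.neutral _).symm
  | succ n ih => rw [← add_assoc, npow_succ, npow_succ, ih, T.assoc]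

theorem npow_toFun (u v : I) (n : ℕ) :
    T.npow (T.toFun u v) n = T.toFun (T.npow u n) (T.npow v n) := by
  induction n with
  | zero => exact (T.neutral _).symm
  | succ n ih => rw [npow_succ, npow_succ, npow_succ, ih, toFun_toFun_toFun_comm]

theorem npow_mul (u : I) (m n : ℕ) : T.npow u (m * n) = T.npow (T.npow u m) n := by
  induction n with
  | zero => rfl
  | succ n ih => rw [Nat.mul_succ, npow_add, ih, npow_succ]

theorem root_le {u v : I} {p : ℕ} (h : u ≤ T.npow v p) : T.root u p ≤ v :=
  sSup_le fun _ hw => le_of_not_gt fun hvw =>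
    (lt_of_lt_of_le hw h).not_ge (T.npow_mono hvw.le p)

end Algebra

/-! ### Rational and real powers for a continuous t-norm -/

section Continuous

variable {T : TNorm}

theorem IsContinuous.left (hT : T.IsContinuous) (x : I) : Continuous fun y => T.toFun x y :=
  hT.comp (continuous_const.prodMk continuous_id)

theorem IsContinuous.npow (hT : T.IsContinuous) (n : ℕ) : Continuous fun v => T.npow v n := by
  induction n with
  | zero => exact continuous_const
  | succ n ih => exact hT.comp (ih.prodMk continuous_id)

theorem IsContinuous.npow_root (hT : T.IsContinuous) (u : I) {p : ℕ} (hp : 0 < p) :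
    T.npow (T.root u p) p = u := by
  have one_npow : T.npow 1 p = 1 := by
    clear hp
    induction p with
    | zero => rfl
    | succ n ih => rw [npow_succ, T.neutral, ih]
  obtain ⟨w, hw⟩ : ∃ w, T.npow w p = u :=
    mem_range_of_exists_le_of_exists_ge (hT.npow p)
      ⟨0, by
        obtain ⟨n, rfl⟩ := Nat.exists_eq_succ_of_ne_zero hp.ne'
        exact (T.le_right _ _).trans unitInterval.nonneg'⟩
      ⟨1, one_npow.symm ▸ unitInterval.le_one'⟩
  have hle : T.root u p ≤ w := T.root_le hw.ge
  refine le_antisymm ((T.npow_mono hle p).trans_eq hw) (le_of_not_gt fun hlt => ?_)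
  have hne : (Set.Ioi (T.root u p)).Nonempty :=
    ⟨w, lt_of_le_of_ne hle fun h => by rw [h, hw] at hlt; exact hlt.false⟩
  -- Everything above the supremum has `p`-th power at least `u`; by continuity this closed
  -- condition passes to the root itself.
  have hsub : Set.Ioi (T.root u p) ⊆ {v | u ≤ T.npow v p} := fun v hv => by
    by_contra h
    exact (show T.root u p < v from hv).not_ge (le_sSup (show T.npow v p < u from lt_of_not_ge h))
  have hclosed : IsClosed {v | u ≤ T.npow v p} := isClosed_le continuous_const (hT.npow p)
  have hmem := closure_minimal hsub hclosed ((closure_Ioi' hne).symm ▸ Set.self_mem_Ici)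
  exact hlt.not_ge hmem

/-- Both inequalities come from minimality of roots. In general the two sides are merely two `p`-th
roots of `u`, and such roots need not be unique. -/
theorem IsContinuous.npow_root_mul (hT : T.IsContinuous) (u : I) {p k : ℕ} (hp : 0 < p)
    (hk : 0 < k) : T.npow (T.root u (p * k)) k = T.root u p := by
  apply le_antisymm
  · have h : T.root u (p * k) ≤ T.root (T.root u p) k := T.root_le <| by
      rw [mul_comm, npow_mul, hT.npow_root _ hk, hT.npow_root _ hp]
    exact (T.npow_mono h k).trans_eq (hT.npow_root _ hk)
  · refine T.root_le ?_
    rw [← npow_mul, mul_comm k p, hT.npow_root _ (Nat.mul_pos hp hk)]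

theorem IsContinuous.ratPow_eq (hT : T.IsContinuous) (u : I) {r : ℚ≥0} {p q : ℕ} (hp : 0 < p)
    (h : r = q / p) : T.ratPow u r = T.npow (T.root u p) q := by
  have hd : 0 < r.den := r.den_pos
  have hcross : p * r.num = r.den * q := by
    have hr : (r.num : ℚ≥0) / r.den = q / p := (NNRat.num_div_den r).trans h
    rw [div_eq_div_iff (by positivity) (by positivity)] at hr
    have : r.num * p = q * r.den := by exact_mod_cast hr
    linarith
  rw [ratPow, ← hT.npow_root_mul u hd hp, ← hT.npow_root_mul u hp hd, ← npow_mul, ← npow_mul,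
    hcross, mul_comm p]

theorem IsContinuous.ratPow_add (hT : T.IsContinuous) (u : I) (r s : ℚ≥0) :
    T.ratPow u (r + s) = T.toFun (T.ratPow u r) (T.ratPow u s) := by
  have hr := r.den_pos
  have hs := s.den_pos
  have er : r = (r.num * s.den : ℕ) / (r.den * s.den : ℕ) := by
    conv_lhs => rw [← NNRat.num_div_den r]
    push_cast
    field_simp
  have es : s = (s.num * r.den : ℕ) / (r.den * s.den : ℕ) := by
    conv_lhs => rw [← NNRat.num_div_den s]
    push_cast
    field_simp
  have ers : r + s = (r.num * s.den + s.num * r.den : ℕ) / (r.den * s.den : ℕ) := by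
    rw [Nat.cast_add, add_div, ← er, ← es]
  have hp := Nat.mul_pos hr hs
  rw [hT.ratPow_eq u hp er, hT.ratPow_eq u hp es, hT.ratPow_eq u hp ers, npow_add]

theorem IsContinuous.ratPow_antitone (hT : T.IsContinuous) (u : I) : Antitone (T.ratPow u) := by
  intro r s h
  rw [← add_tsub_cancel_of_le h, hT.ratPow_add]
  exact T.le_left _ _

/-- By the intermediate value theorem `y = T(e, z)` for some `z`, and multiplying by `e` again
changes nothing. -/
theorem IsContinuous.toFun_eq_left_of_idempotent (hT : T.IsContinuous) {y e : I}
    (he : T.toFun e e = e) (hy : y ≤ e) : T.toFun y e = y := by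
  obtain ⟨z, rfl⟩ : ∃ z, T.toFun e z = y :=
    mem_range_of_exists_le_of_exists_ge (hT.left e)
      ⟨0, (T.le_right _ _).trans unitInterval.nonneg'⟩ ⟨1, (T.neutral e).symm ▸ hy⟩
  rw [T.comm, T.assoc, he]

/-- Rational powers are left-continuous in the exponent. -/
theorem IsContinuous.le_ratPow_of_forall_lt (hT : T.IsContinuous) {u y : I} {q : ℚ≥0}
    (h : ∀ r < q, y ≤ T.ratPow u r) : y ≤ T.ratPow u q := by
  rcases eq_zero_or_pos q with rfl | hq
  · exact unitInterval.le_one'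
  have : Nonempty {r : ℚ≥0 // 0 < r} := ⟨⟨q, hq⟩⟩
  -- The supremum `e` of the positive powers may be below `1`, but halving exponents shows it is
  -- idempotent. Hence `y = T(y, e) = sup_r T(y, u^(r))`, and each term is at most `u^(q)` because
  -- `y ≤ u^(q-r)`.
  set e : I := ⨆ r : {r : ℚ≥0 // 0 < r}, T.ratPow u r with he
  have hle : ∀ r : ℚ≥0, 0 < r → T.ratPow u r ≤ e := fun r hr =>
    le_iSup (fun r : {r : ℚ≥0 // 0 < r} => T.ratPow u r) ⟨r, hr⟩
  have hee : T.toFun e e = e := by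
    refine le_antisymm (T.le_left _ _) (iSup_le fun r => ?_)
    have hr : 0 < (r : ℚ≥0) / 2 := half_pos r.2
    rw [← add_halves (r : ℚ≥0), hT.ratPow_add]
    exact T.mono₂ (hle _ hr) (hle _ hr)
  have hye : y ≤ e := (h _ (half_lt_self hq)).trans (hle _ (half_pos hq))
  rw [← hT.toFun_eq_left_of_idempotent hee hye, he,
    Monotone.map_ciSup_of_continuousAt (hT.left y).continuousAt (fun a b => T.mono y a b)
      (OrderTop.bddAbove _)]
  refine ciSup_le fun r => ?_
  rcases le_or_gt q r with hqr | hrq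
  · exact (T.le_right _ _).trans (hT.ratPow_antitone u hqr)
  · have hsub : q - r < q := tsub_lt_self hq r.2
    calc T.toFun y (T.ratPow u r) ≤ T.toFun (T.ratPow u (q - r)) (T.ratPow u r) :=
          T.mono₂ (h _ hsub) le_rfl
      _ = T.ratPow u q := by rw [← hT.ratPow_add, tsub_add_cancel_of_le hrq.le]

theorem rpow_le_ratPow (u : I) {r : ℚ≥0} {t : ℝ} (h : (r : ℝ) ≤ t) :
    T.rpow u t ≤ T.ratPow u r :=
  sInf_le ⟨r, h, rfl⟩

theorem le_rpow {u y : I} {t : ℝ} (h : ∀ r : ℚ≥0, (r : ℝ) ≤ t → y ≤ T.ratPow u r) :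
    y ≤ T.rpow u t := by
  refine le_sInf ?_
  rintro _ ⟨r, hr, rfl⟩
  exact h r hr

theorem IsContinuous.le_rpow_of_forall_lt (hT : T.IsContinuous) {u y : I} {t : ℝ}
    (h : ∀ r : ℚ≥0, (r : ℝ) < t → y ≤ T.ratPow u r) : y ≤ T.rpow u t :=
  le_rpow fun _ hq => hT.le_ratPow_of_forall_lt fun r hr =>
    h r ((NNRat.cast_lt.2 hr).trans_le hq)

theorem rpow_antitone (u : I) : Antitone (T.rpow u) := fun _ _ h =>
  le_rpow fun _ hr => rpow_le_ratPow u (hr.trans h)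

theorem IsContinuous.le_toFun_rpow (hT : T.IsContinuous) {u x y : I} {t : ℝ} (ht : 0 ≤ t)
    (h : ∀ r : ℚ≥0, (r : ℝ) ≤ t → y ≤ T.toFun x (T.ratPow u r)) :
    y ≤ T.toFun x (T.rpow u t) := by
  -- The infimum may be moved through `T(x, ·)` only over a nonempty set; the exponent `0` supplies
  -- a member.
  have hne : {z : I | ∃ r : ℚ≥0, (r : ℝ) ≤ t ∧ z = T.ratPow u r}.Nonempty :=
    ⟨1, 0, by simpa using ht, rfl⟩
  rw [rpow, Monotone.map_csInf_of_continuousAt (hT.left x).continuousAt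
    (fun a b => T.mono x a b) hne (OrderBot.bddBelow _)]
  refine le_sInf ?_
  rintro _ ⟨_, ⟨r, hr, rfl⟩, rfl⟩
  exact h r hr

theorem IsContinuous.le_toFun_rpow_rpow (hT : T.IsContinuous) {u v y : I} {s t : ℝ}
    (hs : 0 ≤ s) (ht : 0 ≤ t)
    (h : ∀ q r : ℚ≥0, (q : ℝ) ≤ s → (r : ℝ) ≤ t → y ≤ T.toFun (T.ratPow u q) (T.ratPow v r)) :
    y ≤ T.toFun (T.rpow u s) (T.rpow v t) :=
  hT.le_toFun_rpow ht fun r hr => by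
    rw [T.comm]
    refine hT.le_toFun_rpow hs fun q hq => ?_
    rw [T.comm]
    exact h q r hq hr

theorem exists_nnrat_btwn {x y : ℝ} (hx : 0 ≤ x) (h : x < y) :
    ∃ r : ℚ≥0, x < r ∧ (r : ℝ) < y := by
  obtain ⟨q, hxq, hqy⟩ := exists_rat_btwn h
  have hq : 0 ≤ q := by exact_mod_cast hx.trans hxq.le
  exact ⟨⟨q, hq⟩, hxq, hqy⟩

theorem IsContinuous.rpow_add (hT : T.IsContinuous) (u : I) {s t : ℝ} (hs : 0 < s) (ht : 0 < t) :
    T.rpow u (s + t) = T.toFun (T.rpow u s) (T.rpow u t) := by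
  apply le_antisymm
  · refine hT.le_toFun_rpow_rpow hs.le ht.le fun q r hq hr => ?_
    rw [← hT.ratPow_add]
    refine rpow_le_ratPow u ?_
    push_cast
    exact add_le_add hq hr
  · refine hT.le_rpow_of_forall_lt fun r hr => ?_
    obtain ⟨a, b, ha, hb, hab⟩ : ∃ a b : ℚ≥0, (a : ℝ) ≤ s ∧ (b : ℝ) ≤ t ∧ r ≤ a + b := by
      -- Truncation at `0` keeps the chosen exponents nonnegative.
      have h1 : max 0 ((r : ℝ) - t) < s := max_lt hs (by linarith)
      obtain ⟨a, ha, has⟩ := exists_nnrat_btwn (le_max_left _ _) h1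
      have h2 : max 0 ((r : ℝ) - a) < t :=
        max_lt ht (by linarith [le_max_right 0 ((r : ℝ) - t)])
      obtain ⟨b, hb, hbt⟩ := exists_nnrat_btwn (le_max_left _ _) h2
      refine ⟨a, b, has.le, hbt.le, ?_⟩
      have : (r : ℝ) ≤ a + b := by linarith [le_max_right 0 ((r : ℝ) - a)]
      exact_mod_cast this
    calc T.toFun (T.rpow u s) (T.rpow u t) ≤ T.toFun (T.ratPow u a) (T.ratPow u b) :=
          T.mono₂ (rpow_le_ratPow u ha) (rpow_le_ratPow u hb)
      _ = T.ratPow u (a + b) := (hT.ratPow_add u a b).symm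
      _ ≤ T.ratPow u r := hT.ratPow_antitone u hab

theorem IsContinuous.npow_rpow (hT : T.IsContinuous) (u : I) {t : ℝ} (ht : 0 < t) {n : ℕ}
    (hn : 0 < n) : T.npow (T.rpow u t) n = T.rpow u (t * n) := by
  induction n, hn using Nat.le_induction with
  | base => rw [Nat.succ_eq_add_one, zero_add, npow_one, Nat.cast_one, mul_one]
  | succ n hn ih =>
    have hn' : (0 : ℝ) < n := by exact_mod_cast hn
    rw [npow_succ, ih, ← hT.rpow_add u (mul_pos ht hn') ht]
    push_cast
    ring_nf

theorem dual_rpow (u : I) (t : ℝ) : T.dual.rpow u t = σ (T.rpow (σ u) t) := by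
  refine le_antisymm (T.dual_rpow_le u t) ?_
  rw [unitInterval.symm_le_comm]
  refine le_rpow fun r hr => ?_
  rw [unitInterval.symm_le_comm]
  refine le_sSup ⟨r, hr, ?_⟩
  simp only [TConorm.ratPow, ratPow, dual_npow, dual_root]
  simp only [unitInterval.symm_symm]

end Continuous

/-! ### T-norms with strictly increasing diagonal -/

section StrictDiagonal

variable {T : TNorm}

theorem strictMono_diag_minimum : StrictMono fun x => minimum.toFun x x := fun x y h => by
  change min x x < min y y
  rwa [min_self, min_self]

theorem IsStrict.strictMono_diag (hT : T.IsStrict) : StrictMono fun x => T.toFun x x := by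
  intro x y h
  -- Strictness needs a positive fixed argument, so at `x = 0` the fixed argument is `y`.
  rcases eq_or_ne x 0 with rfl | hx
  · exact (T.le_left 0 0).trans_lt
      (lt_of_le_of_lt unitInterval.nonneg' (hT.2 y 0 y h h))
  · exact (hT.2 x x y (unitInterval.pos_iff_ne_zero.2 hx) h).trans_le (T.mono₂ h.le le_rfl)

/-- Outside the summands the diagonal is the identity; inside one it is a rescaled strict diagonal,
staying above the left endpoint. -/
theorem IsOrdinalSumOfStrict.strictMono_diag (hT : T.IsOrdinalSumOfStrict) :
    StrictMono fun x => T.toFun x x := by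
  obtain ⟨ι, -, a, e, T', hstrict, hae, -, hin, hout⟩ := hT
  intro x y hxy
  change T.toFun x x < T.toFun y y
  by_cases hy : ∃ i, y ∈ Set.Icc (a i) (e i)
  · obtain ⟨i, hyi⟩ := hy
    have hpos : (0 : ℝ) < e i - a i := sub_pos.2 (hae i)
    rcases lt_or_ge x (a i) with hx | hx
    · refine (T.le_left x x).trans_lt (hx.trans_le ?_)
      change (a i : ℝ) ≤ (T.toFun y y : ℝ)
      rw [hin i y y hyi hyi]
      exact le_add_of_nonneg_right (mul_nonneg hpos.le (unitInterval.nonneg _))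
    · have hxi : x ∈ Set.Icc (a i) (e i) := ⟨hx, hxy.le.trans hyi.2⟩
      have hlt : rescale (a i) (e i) x (hae i) hxi < rescale (a i) (e i) y (hae i) hyi :=
        div_lt_div_of_pos_right (sub_lt_sub_right (show (x : ℝ) < y from hxy) _) hpos
      have hT' : ((T' i).toFun _ _ : ℝ) < (T' i).toFun _ _ := (hstrict i).strictMono_diag hlt
      change (T.toFun x x : ℝ) < (T.toFun y y : ℝ)
      rw [hin i x x hxi hxi, hin i y y hyi hyi]
      gcongr
  · rw [hout y y fun ⟨i, h, _⟩ => hy ⟨i, h⟩, min_self]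
    exact (T.le_left x x).trans_lt hxy

/-- Squeezing `T(y^n, x)` between the equal powers `x^(n+1)` and `y^(n+1)` lets one factor `x` be
traded for `y`. -/
theorem npow_add_two_eq_of_npow_succ_eq {x y : I} (hxy : x ≤ y) {n : ℕ}
    (h : T.npow x (n + 1) = T.npow y (n + 1)) : T.npow x (n + 2) = T.npow y (n + 2) := by
  have hmid : T.toFun (T.npow y n) x = T.npow y (n + 1) :=
    le_antisymm (T.mono₂ le_rfl hxy) (h.symm.trans_le (T.mono₂ (T.npow_mono hxy n) le_rfl))
  rw [npow_succ, h, npow_succ T y n, ← T.assoc, T.comm y x, T.assoc, hmid]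
  rfl

theorem strictMono_npow_two_pow (hD : StrictMono fun x => T.toFun x x) (k : ℕ) :
    StrictMono fun x => T.npow x (2 ^ k) := by
  induction k with
  | zero =>
    simp only [pow_zero, npow_one]
    exact strictMono_id
  | succ k ih =>
    simp only [pow_succ, mul_two, npow_add]
    exact hD.comp ih

/-- Equality of `p`-th powers propagates to all higher exponents, in particular to `2 ^ p`, where
the power map is an iterated diagonal and so strictly increasing. -/
theorem npow_injective (hD : StrictMono fun x => T.toFun x x) {p : ℕ} (hp : 0 < p) :
    Function.Injective fun x => T.npow x p := by
  have key : ∀ x y : I, x ≤ y → T.npow x p = T.npow y p → x = y := by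
    intro x y hxy h
    have hall : ∀ m, p ≤ m → T.npow x m = T.npow y m := by
      intro m hm
      induction m, hm using Nat.le_induction with
      | base => exact h
      | succ m hm ih =>
        obtain ⟨n, rfl⟩ := Nat.exists_eq_succ_of_ne_zero (hp.trans_le hm).ne'
        exact npow_add_two_eq_of_npow_succ_eq hxy ih
    exact (strictMono_npow_two_pow hD p).injective (hall _ p.lt_two_pow_self.le)
  intro x y h
  rcases le_total x y with hxy | hxy
  · exact key x y hxy h
  · exact (key y x hxy h.symm).symm

theorem IsContinuous.root_eq (hT : T.IsContinuous) (hD : StrictMono fun x => T.toFun x x)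
    {u v : I} {p : ℕ} (hp : 0 < p) (h : T.npow v p = u) : T.root u p = v :=
  npow_injective hD hp ((hT.npow_root u hp).trans h.symm)

theorem IsContinuous.ratPow_toFun (hT : T.IsContinuous) (hD : StrictMono fun x => T.toFun x x)
    (u v : I) (r : ℚ≥0) :
    T.ratPow (T.toFun u v) r = T.toFun (T.ratPow u r) (T.ratPow v r) := by
  have hroot : T.root (T.toFun u v) r.den = T.toFun (T.root u r.den) (T.root v r.den) :=
    hT.root_eq hD r.den_pos <| by
      rw [npow_toFun, hT.npow_root u r.den_pos, hT.npow_root v r.den_pos]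
  rw [ratPow, hroot, npow_toFun]
  rfl

theorem IsContinuous.rpow_toFun (hT : T.IsContinuous) (hD : StrictMono fun x => T.toFun x x)
    (u v : I) {t : ℝ} (ht : 0 ≤ t) :
    T.rpow (T.toFun u v) t = T.toFun (T.rpow u t) (T.rpow v t) := by
  apply le_antisymm
  · refine hT.le_toFun_rpow_rpow ht ht fun q r hq hr => ?_
    -- The two infima run over independent exponents; antitonicity replaces both by the larger one.
    have hmax : ((max q r : ℚ≥0) : ℝ) ≤ t := by
      rcases max_choice q r with h | h <;> rwa [h]
    refine (rpow_le_ratPow _ hmax).trans ?_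
    rw [hT.ratPow_toFun hD]
    exact T.mono₂ (hT.ratPow_antitone u (le_max_left _ _))
      (hT.ratPow_antitone v (le_max_right _ _))
  · refine le_rpow fun r hr => ?_
    rw [hT.ratPow_toFun hD]
    exact T.mono₂ (rpow_le_ratPow u hr) (rpow_le_ratPow v hr)

theorem IsContinuous.ratPow_rpow (hT : T.IsContinuous) (hD : StrictMono fun x => T.toFun x x)
    (u : I) {t : ℝ} (ht : 0 < t) {r : ℚ≥0} (hr : 0 < r) :
    T.ratPow (T.rpow u t) r = T.rpow u (t * r) := by
  have hd : (0 : ℝ) < r.den := by exact_mod_cast r.den_pos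
  have hroot : T.root (T.rpow u t) r.den = T.rpow u (t / r.den) :=
    hT.root_eq hD r.den_pos <| by
      rw [hT.npow_rpow u (div_pos ht hd) r.den_pos, div_mul_cancel₀ _ hd.ne']
  rw [ratPow, hroot, hT.npow_rpow u (div_pos ht hd) (NNRat.num_pos.2 hr), NNRat.cast_def r]
  ring_nf

theorem IsContinuous.rpow_rpow (hT : T.IsContinuous) (hD : StrictMono fun x => T.toFun x x)
    (u : I) {s : ℝ} (hs : 0 < s) (t : ℝ) :
    T.rpow (T.rpow u s) t = T.rpow u (s * t) := by
  apply le_antisymm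
  · refine hT.le_rpow_of_forall_lt fun r hr => ?_
    -- Left continuity allows `r < s * t`, which leaves room for a rational `q` with `r / s < q <
    -- t`.
    obtain ⟨q, hq, hqt⟩ := exists_nnrat_btwn (div_nonneg r.cast_nonneg hs.le)
      ((div_lt_iff₀' hs).2 hr)
    have hq0 : 0 < q := by
      exact_mod_cast (div_nonneg (NNRat.cast_nonneg (α := ℝ) r) hs.le).trans_lt hq
    refine (rpow_le_ratPow _ hqt.le).trans ?_
    rw [hT.ratPow_rpow hD u hs hq0]
    exact rpow_le_ratPow u ((div_le_iff₀' hs).1 hq.le)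
  · refine le_rpow fun r hr => ?_
    rcases eq_zero_or_pos r with rfl | hr0
    · exact unitInterval.le_one'
    · rw [hT.ratPow_rpow hD u hs hr0]
      exact rpow_antitone u (mul_le_mul_of_nonneg_left hr hs.le)

end StrictDiagonal

theorem dual_toFun (T : TNorm) (x y : I) : T.dual.toFun x y = σ (T.toFun (σ x) (σ y)) := rfl

end TNorm

theorem mainTheorem9 (T : TNorm) (hT : T.IsContinuous) (γ₁ γ₂ γ₃ : IFValue)
    (ζ ξ l : ℝ) (hζ : 0 < ζ) (hξ : 0 < ξ) (hl : 0 < l) :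
    (γ₁.oplus T γ₂ = γ₂.oplus T γ₁ ∧
      γ₁.otimes T γ₂ = γ₂.otimes T γ₁ ∧
      (γ₁.oplus T γ₂).oplus T γ₃ = γ₁.oplus T (γ₂.oplus T γ₃) ∧
      (γ₁.otimes T γ₂).otimes T γ₃ = γ₁.otimes T (γ₂.otimes T γ₃) ∧
      (γ₁.smul T ξ).oplus T (γ₁.smul T ζ) = γ₁.smul T (ξ + ζ) ∧
      (γ₁.power T ξ).otimes T (γ₁.power T ζ) = γ₁.power T (ξ + ζ)) ∧
    (T = TNorm.minimum ∨ T.IsStrict ∨ T.IsOrdinalSumOfStrict →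
      (γ₁.oplus T γ₂).smul T l = (γ₁.smul T l).oplus T (γ₂.smul T l) ∧
      (γ₁.otimes T γ₂).power T l = (γ₁.power T l).otimes T (γ₂.power T l) ∧
      (γ₁.power T l).power T ξ = γ₁.power T (l * ξ) ∧
      (γ₁.smul T l).smul T ξ = γ₁.smul T (l * ξ)) := by
  have hadd := fun u => hT.rpow_add u hξ hζ
  refine ⟨⟨?_, ?_, ?_, ?_, ?_, ?_⟩, fun h => ?_⟩
  · exact IFValue.ext (T.dual.comm _ _) (T.comm _ _)
  · exact IFValue.ext (T.comm _ _) (T.dual.comm _ _)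
  · exact IFValue.ext (T.dual.assoc _ _ _).symm (T.assoc _ _ _).symm
  · exact IFValue.ext (T.assoc _ _ _).symm (T.dual.assoc _ _ _).symm
  · ext1 <;> simp only [IFValue.oplus, IFValue.smul, TNorm.dual_rpow, TNorm.dual_toFun,
      unitInterval.symm_symm, hadd]
  · ext1 <;> simp only [IFValue.otimes, IFValue.power, TNorm.dual_rpow, TNorm.dual_toFun,
      unitInterval.symm_symm, hadd]
  have hD : StrictMono fun x => T.toFun x x := by
    rcases h with rfl | h | h
    · exact TNorm.strictMono_diag_minimum
    · exact h.strictMono_diag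
    · exact h.strictMono_diag
  have hmul := fun u v => hT.rpow_toFun hD u v hl.le
  have hpow := fun u => hT.rpow_rpow hD u hl ξ
  refine ⟨?_, ?_, ?_, ?_⟩
  · ext1 <;> simp only [IFValue.oplus, IFValue.smul, TNorm.dual_rpow, TNorm.dual_toFun,
      unitInterval.symm_symm, hmul]
  · ext1 <;> simp only [IFValue.otimes, IFValue.power, TNorm.dual_rpow, TNorm.dual_toFun,
      unitInterval.symm_symm, hmul]
  · ext1 <;> simp only [IFValue.power, TNorm.dual_rpow, unitInterval.symm_symm, hpow]
  · ext1 <;> simp only [IFValue.smul, TNorm.dual_rpow, unitInterval.symm_symm, hpow]
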